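/- Let $(M,g_M)$ be a Lorentzian manifold (signature $(-,+,\dots,+)$) of dimension $2m+1$ carrying a Lorentzian almost contact structure ($\varepsilon=-1$) or a Lorentzian almost paracontact structure ($\varepsilon=1$), that is, a $(1,1)$-tensor field $\phi$, a vector field $\xi$ and a $1$-form $\eta$ with $$\phi^2X=\varepsilon X+\eta(X)\xi,\quad g_M(\phi X,\phi Y)=g_M(X,Y)+\eta(X)\eta(Y),\quad \eta(X)=\varepsilon g_M(X,\xi),\quad \eta(\xi)=-\varepsilon$$ for all vector fields $X,Y$. Let $\nabla$ be the Levi-Civita connection of $g_M$, and suppose that $M$ is Lorentzian (para) Sasakian, i.e. $(\nabla_X\phi)Y=g_M(\phi X,\phi Y)\xi+\eta(Y)\phi^2X$ for all $X,Y$, or, more generally, that $\nabla_X\xi=\varepsilon\phi X$ for all $X$. Let $(N,g_N)$ be a Riemannian manifold of dimension $n<2m$, and let $F:M\to N$ be an anti-invariant semi-Riemannian submersion: a smooth surjective submersion whose fibers are semi-Riemannian submanifolds (the restriction of $g_M$ to $\ker F_*$ is nondegenerate), whose differential preserves the scalar products of vectors normal to the fibers, and with $\phi(\ker F_*)\subseteq(\ker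 F_*)^\perp$. Suppose that $\xi$ is vertical, i.e. tangent to the fibers. Then no fiber $F^{-1}(q)$, $q\in N$, is a totally umbilical submanifold of $M$. (A fiber is totally umbilical if there is a normal vector field $Z$ along it such that its second fundamental form satisfies $II(U,V)=g_M(U,V)Z$ for all vector fields $U,V$ tangent to it.) -/

import Mathlib

open Bundle VectorField Module
open scoped Manifold ContDiff

noncomputable section

namespace SemiRiem

section Metric

variable {E : Type*} [NormedAddCommGroup E] [NormedSpace ℝ E]
  {H : Type*} [TopologicalSpace H] (I : ModelWithCorners ℝ E H)
  (M : Type*) [TopologicalSpace M] [ChartedSpace H M] [IsManifold I ∞ M]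

/-- A semi-Riemannian metric: a smooth symmetric nondegenerate `(0,2)`-tensor field. -/
structure Metric where
  val : ∀ x : M, TangentSpace I x →L[ℝ] TangentSpace I x →L[ℝ] ℝ
  symm : ∀ (x : M) (v w : TangentSpace I x), val x v w = val x w v
  nondegenerate : ∀ (x : M) (v : TangentSpace I x), (∀ w, val x v w = 0) → v = 0
  contMDiff : ContMDiff I (I.prod 𝓘(ℝ, E →L[ℝ] E →L[ℝ] ℝ)) ∞
    (fun x ↦ TotalSpace.mk' (E →L[ℝ] E →L[ℝ] ℝ) x (val x))

end Metric

section LeviCivita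

variable {E : Type*} [NormedAddCommGroup E] [NormedSpace ℝ E]
  {H : Type*} [TopologicalSpace H] {I : ModelWithCorners ℝ E H}
  {M : Type*} [TopologicalSpace M] [ChartedSpace H M] [IsManifold I ∞ M]

/-- Positive definite at every point. -/
def Metric.IsRiemannian (g : Metric I M) : Prop :=
  ∀ (x : M) (v : TangentSpace I x), v ≠ 0 → 0 < g.val x v v

/-- Signature `(-, +, …, +)` at every point: some vector is timelike and the metric is positive
definite on its orthogonal complement. -/
def Metric.IsLorentzian (g : Metric I M) : Prop :=
  ∀ x : M, ∃ t : TangentSpace I x, g.val x t t < 0 ∧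
    ∀ v : TangentSpace I x, g.val x t v = 0 → v ≠ 0 → 0 < g.val x v v

/-- The function `x ↦ g(X, Y)(x)`. -/
def Metric.pair (g : Metric I M) (X Y : Π x : M, TangentSpace I x) : M → ℝ :=
  fun x ↦ g.val x (X x) (Y x)

/-- The right-hand side of the Koszul formula, which has to equal `g(∇_X Y, Z)` at `x`. -/
def Metric.koszul (g : Metric I M) (X Y Z : Π x : M, TangentSpace I x) (x : M) : ℝ :=
  (1 / 2) * (d% (g.pair Y Z) x (X x) + d% (g.pair Z X) x (Y x) - d% (g.pair X Y) x (Z x)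
    + g.val x (mlieBracket I X Y x) (Z x) - g.val x (mlieBracket I X Z x) (Y x)
    - g.val x (mlieBracket I Y Z x) (X x))

variable {g : Metric I M} {X X' Y Y' Z Z' : Π x : M, TangentSpace I x} {x : M}

theorem Metric.pair_comm (g : Metric I M) (X Y : Π x : M, TangentSpace I x) :
    g.pair X Y = g.pair Y X := funext fun x ↦ g.symm x _ _

theorem Metric.mdifferentiableAt_pair (g : Metric I M)
    (hX : MDiffAt (T% X) x) (hY : MDiffAt (T% Y) x) : MDiffAt (g.pair X Y) x := by
  have : MDifferentiableAt I (I.prod 𝓘(ℝ)) (fun m ↦ TotalSpace.mk' ℝ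
      (E := Bundle.Trivial M ℝ) m (g.val m (X m) (Y m))) x :=
    MDifferentiableAt.clm_bundle_apply₂ (F₁ := E) (F₂ := E)
      (g.contMDiff.mdifferentiable (by simp) x) hX hY
  simp only [mdifferentiableAt_totalSpace] at this
  exact this.2

theorem Metric.pair_smul_left (g : Metric I M) (f : M → ℝ) (X Y : Π x : M, TangentSpace I x) :
    g.pair (f • X) Y = f * g.pair X Y := by
  funext y; simp [Metric.pair]

theorem Metric.pair_smul_right (g : Metric I M) (f : M → ℝ) (X Y : Π x : M, TangentSpace I x) :
    g.pair X (f • Y) = f * g.pair X Y := by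
  funext y; simp [Metric.pair]

theorem Metric.pair_add_left (g : Metric I M) (X X' Y : Π x : M, TangentSpace I x) :
    g.pair (X + X') Y = g.pair X Y + g.pair X' Y := by
  funext y; simp [Metric.pair]

theorem Metric.pair_add_right (g : Metric I M) (X Y Y' : Π x : M, TangentSpace I x) :
    g.pair X (Y + Y') = g.pair X Y + g.pair X Y' := by
  funext y; simp [Metric.pair]

theorem Metric.ext_val (g : Metric I M) {v w : TangentSpace I x}
    (h : ∀ u, g.val x v u = g.val x w u) : v = w := by
  rw [← sub_eq_zero]
  exact g.nondegenerate x _ fun u ↦ by simp [h u]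

variable [FiniteDimensional ℝ E]

theorem Metric.koszul_tensorial_left (g : Metric I M)
    (hY : MDiffAt (T% Y) x) (hZ : MDiffAt (T% Z) x) :
    TensorialAt I E (fun X ↦ g.koszul X Y Z x) x where
  smul {f X} hf hX := by
    have h1 := g.mdifferentiableAt_pair hZ hX
    have h2 := g.mdifferentiableAt_pair hX hY
    have e1 : g.val x (Z x) (X x) = g.val x (X x) (Z x) := g.symm _ _ _
    simp [Metric.koszul, Metric.pair_smul_left, Metric.pair_smul_right, mvfderiv_mul hf h1,
      mvfderiv_mul hf h2, mlieBracket_smul_left hf hX]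
    simp only [Metric.pair, e1]
    ring
  add {X X'} hX hX' := by
    simp [Metric.koszul, Metric.pair_add_left, Metric.pair_add_right,
      mvfderiv_add (g.mdifferentiableAt_pair hZ hX) (g.mdifferentiableAt_pair hZ hX'),
      mvfderiv_add (g.mdifferentiableAt_pair hX hY) (g.mdifferentiableAt_pair hX' hY),
      mlieBracket_add_left hX hX']
    ring

theorem Metric.koszul_tensorial_right (g : Metric I M)
    (hX : MDiffAt (T% X) x) (hY : MDiffAt (T% Y) x) :
    TensorialAt I E (fun Z ↦ g.koszul X Y Z x) x where
  smul {f Z} hf hZ := by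
    have e1 : g.val x (Z x) (X x) = g.val x (X x) (Z x) := g.symm _ _ _
    have e2 : g.val x (Z x) (Y x) = g.val x (Y x) (Z x) := g.symm _ _ _
    simp [Metric.koszul, Metric.pair_smul_left, Metric.pair_smul_right,
      mvfderiv_mul hf (g.mdifferentiableAt_pair hY hZ),
      mvfderiv_mul hf (g.mdifferentiableAt_pair hZ hX), mlieBracket_smul_right hf hZ]
    simp only [Metric.pair, e1, e2]
    ring
  add {Z Z'} hZ hZ' := by
    simp [Metric.koszul, Metric.pair_add_left, Metric.pair_add_right,
      mvfderiv_add (g.mdifferentiableAt_pair hZ hX) (g.mdifferentiableAt_pair hZ' hX),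
      mvfderiv_add (g.mdifferentiableAt_pair hY hZ) (g.mdifferentiableAt_pair hY hZ'),
      mlieBracket_add_right hZ hZ']
    ring

theorem Metric.koszul_add (g : Metric I M) (hX : MDiffAt (T% X) x) (hY : MDiffAt (T% Y) x)
    (hY' : MDiffAt (T% Y') x) (hZ : MDiffAt (T% Z) x) :
    g.koszul X (Y + Y') Z x = g.koszul X Y Z x + g.koszul X Y' Z x := by
  simp [Metric.koszul, Metric.pair_add_left, Metric.pair_add_right,
    mvfderiv_add (g.mdifferentiableAt_pair hY hZ) (g.mdifferentiableAt_pair hY' hZ),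
    mvfderiv_add (g.mdifferentiableAt_pair hX hY) (g.mdifferentiableAt_pair hX hY'),
    mlieBracket_add_right hY hY', mlieBracket_add_left hY hY']
  ring

theorem Metric.koszul_leibniz (g : Metric I M) {f : M → ℝ} (hf : MDiffAt f x)
    (hX : MDiffAt (T% X) x) (hY : MDiffAt (T% Y) x) (hZ : MDiffAt (T% Z) x) :
    g.koszul X (f • Y) Z x = f x * g.koszul X Y Z x + d% f x (X x) * g.val x (Y x) (Z x) := by
  have e1 : g.val x (Y x) (X x) = g.val x (X x) (Y x) := g.symm _ _ _
  simp [Metric.koszul, Metric.pair_smul_left, Metric.pair_smul_right,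
    mvfderiv_mul hf (g.mdifferentiableAt_pair hY hZ),
    mvfderiv_mul hf (g.mdifferentiableAt_pair hX hY),
    mlieBracket_smul_right hf hY, mlieBracket_smul_left hf hY]
  simp only [Metric.pair, e1]
  ring

/-- The metric identifies the tangent space with its dual. -/
theorem Metric.flat_bijective (g : Metric I M) (x : M) :
    Function.Bijective ((g.val x : TangentSpace I x →L[ℝ] TangentSpace I x →L[ℝ] ℝ) :
      TangentSpace I x →ₗ[ℝ] (TangentSpace I x →L[ℝ] ℝ)) := by
  have : FiniteDimensional ℝ (TangentSpace I x) := inferInstanceAs (FiniteDimensional ℝ E)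
  have : T2Space (TangentSpace I x) := inferInstanceAs (T2Space E)
  have hinj : Function.Injective ((g.val x : TangentSpace I x →L[ℝ] TangentSpace I x →L[ℝ] ℝ) :
      TangentSpace I x →ₗ[ℝ] (TangentSpace I x →L[ℝ] ℝ)) := by
    rw [injective_iff_map_eq_zero]
    intro v hv
    refine g.nondegenerate x v fun w ↦ ?_
    exact congrArg (fun l : TangentSpace I x →L[ℝ] ℝ ↦ l w) hv
  have hdim : finrank ℝ (TangentSpace I x) = finrank ℝ (TangentSpace I x →L[ℝ] ℝ) := by
    rw [← (LinearMap.toContinuousLinearMap (𝕜 := ℝ) (E := TangentSpace I x)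
      (F' := ℝ)).finrank_eq]
    exact (Subspace.dual_finrank_eq (K := ℝ) (V := TangentSpace I x)).symm
  have : FiniteDimensional ℝ (TangentSpace I x →L[ℝ] ℝ) :=
    (LinearMap.toContinuousLinearMap (𝕜 := ℝ) (E := TangentSpace I x)
      (F' := ℝ)).finiteDimensional
  exact ⟨hinj, (LinearMap.injective_iff_surjective_of_finrank_eq_finrank hdim).1 hinj⟩

/-- The inverse of the identification of the tangent space with its dual. -/
def Metric.sharp (g : Metric I M) (x : M) :
    (TangentSpace I x →L[ℝ] ℝ) →ₗ[ℝ] TangentSpace I x :=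
  (LinearEquiv.ofBijective _ (g.flat_bijective x)).symm.toLinearMap

@[simp] theorem Metric.val_sharp (g : Metric I M) (x : M) (l : TangentSpace I x →L[ℝ] ℝ)
    (w : TangentSpace I x) : g.val x (g.sharp x l) w = l w :=
  congrArg (fun l : TangentSpace I x →L[ℝ] ℝ ↦ l w)
    ((LinearEquiv.ofBijective _ (g.flat_bijective x)).apply_symm_apply l)

open Classical in
/-- The Levi-Civita connection as a bare map: `leviCivitaFun Y x v` is `∇_v Y`, determined by
the Koszul formula. (At points where `Y` is not differentiable, it is `0`.) -/
def Metric.leviCivitaFun (g : Metric I M) (Y : Π x : M, TangentSpace I x) (x : M) :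
    TangentSpace I x →L[ℝ] TangentSpace I x :=
  if hY : MDiffAt (T% Y) x then
    have : FiniteDimensional ℝ (TangentSpace I x) := inferInstanceAs (FiniteDimensional ℝ E)
    have : T2Space (TangentSpace I x) := inferInstanceAs (T2Space E)
    LinearMap.toContinuousLinearMap (g.sharp x ∘ₗ
      (TensorialAt.mkHom₂ (I := I) (F := E) (F' := E) (fun X Z ↦ g.koszul X Y Z x) x
        (fun _ hZ ↦ g.koszul_tensorial_left hY hZ)
        (fun _ hX ↦ g.koszul_tensorial_right hX hY)).toLinearMap)
  else 0

/-- The Koszul formula. -/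
theorem Metric.leviCivitaFun_koszul (g : Metric I M) (hX : MDiffAt (T% X) x)
    (hY : MDiffAt (T% Y) x) (hZ : MDiffAt (T% Z) x) :
    g.val x (g.leviCivitaFun Y x (X x)) (Z x) = g.koszul X Y Z x := by
  simp only [Metric.leviCivitaFun, hY, dif_pos, LinearMap.coe_toContinuousLinearMap',
    LinearMap.comp_apply, Metric.val_sharp]
  exact TensorialAt.mkHom₂_apply (I := I) (F := E) (F' := E)
    (fun _ hZ ↦ g.koszul_tensorial_left hY hZ)
    (fun _ hX ↦ g.koszul_tensorial_right hX hY) hX hZ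

theorem Metric.leviCivitaFun_ext (g : Metric I M) {L : TangentSpace I x →L[ℝ] TangentSpace I x}
    (hY : MDiffAt (T% Y) x)
    (h : ∀ X Z : Π x : M, TangentSpace I x, MDiffAt (T% X) x → MDiffAt (T% Z) x →
      g.koszul X Y Z x = g.val x (L (X x)) (Z x)) : g.leviCivitaFun Y x = L := by
  ext v
  refine g.ext_val fun w ↦ ?_
  have hv := FiberBundle.mdifferentiableAt_extend I E (V := (TangentSpace I : M → Type _)) v
  have hw := FiberBundle.mdifferentiableAt_extend I E (V := (TangentSpace I : M → Type _)) w
  have := g.leviCivitaFun_koszul hv hY hw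
  rw [h _ _ hv hw] at this
  simpa using this

/-- The Levi-Civita connection; `g.leviCivita Y x v` is `∇_v Y` at the point `x`. -/
def Metric.leviCivita (g : Metric I M) :
    CovariantDerivative I E (TangentSpace I : M → Type _) where
  toFun := g.leviCivitaFun
  isCovariantDerivativeOnUniv :=
    { add := by
        intro Y Y' x hY hY' _
        refine g.leviCivitaFun_ext (mdifferentiableAt_add_section hY hY') fun X Z hX hZ ↦ ?_
        rw [g.koszul_add hX hY hY' hZ, ← g.leviCivitaFun_koszul hX hY hZ,
          ← g.leviCivitaFun_koszul hX hY' hZ]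
        simp
      leibniz := by
        intro Y f x hY hf _
        refine g.leviCivitaFun_ext (hf.smul_section hY) fun X Z hX hZ ↦ ?_
        rw [g.koszul_leibniz hf hX hY hZ, ← g.leviCivitaFun_koszul hX hY hZ]
        simp }

/-- The Levi-Civita connection is torsion free. -/
theorem Metric.leviCivita_torsion (g : Metric I M) (hX : MDiffAt (T% X) x)
    (hY : MDiffAt (T% Y) x) :
    g.leviCivita Y x (X x) - g.leviCivita X x (Y x) = mlieBracket I X Y x := by
  refine g.ext_val fun w ↦ ?_
  have hw := FiberBundle.mdifferentiableAt_extend I E (V := (TangentSpace I : M → Type _)) w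
  have h1 := g.leviCivitaFun_koszul hX hY hw
  have h2 := g.leviCivitaFun_koszul hY hX hw
  rw [FiberBundle.extend_apply_self] at h1 h2
  change g.val x (g.leviCivitaFun Y x (X x) - g.leviCivitaFun X x (Y x)) w = _
  rw [map_sub, sub_apply, h1, h2]
  simp only [Metric.koszul, FiberBundle.extend_apply_self]
  rw [g.pair_comm X Y, mlieBracket_swap_apply (V := Y) (W := X),
    g.pair_comm X (FiberBundle.extend E w), g.pair_comm Y (FiberBundle.extend E w)]
  simp
  ring

/-- The Levi-Civita connection is compatible with the metric. -/
theorem Metric.leviCivita_metric (g : Metric I M) (hX : MDiffAt (T% X) x)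
    (hY : MDiffAt (T% Y) x) (hZ : MDiffAt (T% Z) x) :
    d% (g.pair Y Z) x (X x) =
      g.val x (g.leviCivita Y x (X x)) (Z x) + g.val x (Y x) (g.leviCivita Z x (X x)) := by
  have h1 := g.leviCivitaFun_koszul hX hY hZ
  have h2 := g.leviCivitaFun_koszul hX hZ hY
  change _ = g.val x (g.leviCivitaFun Y x (X x)) (Z x) + g.val x (Y x) (g.leviCivitaFun Z x (X x))
  rw [g.symm x (Y x), h1, h2]
  simp only [Metric.koszul]
  rw [g.pair_comm Z Y, mlieBracket_swap_apply (V := Z) (W := Y), g.pair_comm X Y, g.pair_comm Z X]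
  simp
  ring

end LeviCivita

section AlmostContact

variable {E : Type*} [NormedAddCommGroup E] [NormedSpace ℝ E]
  {H : Type*} [TopologicalSpace H] {I : ModelWithCorners ℝ E H}
  {M : Type*} [TopologicalSpace M] [ChartedSpace H M] [IsManifold I ∞ M]

/-- A Lorentzian almost contact structure (`ε = -1`) or Lorentzian almost paracontact structure
(`ε = 1`) `(φ, ξ, η, g)`. -/
structure LorentzianAlmostContact (g : Metric I M) (ε : ℝ) where
  phi : ∀ x : M, TangentSpace I x →L[ℝ] TangentSpace I x
  xi : ∀ x : M, TangentSpace I x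
  eta : ∀ x : M, TangentSpace I x →L[ℝ] ℝ
  eps_eq : ε = -1 ∨ ε = 1
  isLorentzian : g.IsLorentzian
  contMDiff_phi : ContMDiff I (I.prod 𝓘(ℝ, E →L[ℝ] E)) ∞
    (fun x ↦ (⟨x, phi x⟩ : TotalSpace (E →L[ℝ] E)
      (fun x : M ↦ TangentSpace I x →L[ℝ] TangentSpace I x)))
  contMDiff_xi : ContMDiff I I.tangent ∞ (fun x ↦ (⟨x, xi x⟩ : TangentBundle I M))
  contMDiff_eta : ContMDiff I (I.prod 𝓘(ℝ, E →L[ℝ] ℝ)) ∞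
    (fun x ↦ (⟨x, eta x⟩ : TotalSpace (E →L[ℝ] ℝ)
      (fun x : M ↦ TangentSpace I x →L[ℝ] Bundle.Trivial M ℝ x)))
  phi_phi : ∀ (x : M) (v : TangentSpace I x), phi x (phi x v) = ε • v + eta x v • xi x
  metric_phi : ∀ (x : M) (v w : TangentSpace I x),
    g.val x (phi x v) (phi x w) = g.val x v w + eta x v * eta x w
  eta_eq : ∀ (x : M) (v : TangentSpace I x), eta x v = ε * g.val x v (xi x)
  eta_xi : ∀ x : M, eta x (xi x) = -ε

variable [FiniteDimensional ℝ E] {g : Metric I M} {ε : ℝ}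

/-- Lorentzian Sasakian (`ε = -1`) or Lorentzian para Sasakian (`ε = 1`):
`(∇_X φ) Y = g(φ X, φ Y) ξ + η(Y) φ² X`, where `(∇_X φ) Y = ∇_X (φ Y) - φ (∇_X Y)`. -/
def LorentzianAlmostContact.IsSasakian (S : LorentzianAlmostContact g ε) : Prop :=
  ∀ Y : (∀ x : M, TangentSpace I x), CMDiff ∞ (T% Y) → ∀ (x : M) (v : TangentSpace I x),
    g.leviCivita (fun y ↦ S.phi y (Y y)) x v - S.phi x (g.leviCivita Y x v) =
      g.val x (S.phi x v) (S.phi x (Y x)) • S.xi x + S.eta x (Y x) • S.phi x (S.phi x v)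

/-- The identity `∇_X ξ = ε φ X`, which holds on K-(para)contact and on (para) Sasakian
manifolds. -/
def LorentzianAlmostContact.NablaXiEq (S : LorentzianAlmostContact g ε) : Prop :=
  ∀ (x : M) (v : TangentSpace I x), g.leviCivita S.xi x v = ε • S.phi x v

end AlmostContact

section Submersion

variable {E : Type*} [NormedAddCommGroup E] [NormedSpace ℝ E]
  {H : Type*} [TopologicalSpace H] {I : ModelWithCorners ℝ E H}
  {M : Type*} [TopologicalSpace M] [ChartedSpace H M] [IsManifold I ∞ M]
  {E' : Type*} [NormedAddCommGroup E'] [NormedSpace ℝ E']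
  {H' : Type*} [TopologicalSpace H'] {J : ModelWithCorners ℝ E' H'}
  {N : Type*} [TopologicalSpace N] [ChartedSpace H' N] [IsManifold J ∞ N]

variable (I J) in
/-- A vector `v ∈ T_x M` is vertical, i.e. tangent to the fiber of `F` through `x`. -/
def IsVertical (F : M → N) (x : M) (v : TangentSpace I x) : Prop :=
  mfderiv I J F x v = 0

variable (J) in
/-- A vector `v ∈ T_x M` is horizontal, i.e. normal to the fiber of `F` through `x`. -/
def IsHorizontal (g : Metric I M) (F : M → N) (x : M) (v : TangentSpace I x) : Prop :=
  ∀ u : TangentSpace I x, IsVertical I J F x u → g.val x v u = 0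

/-- A semi-Riemannian submersion of `(M, g)` onto `(N, h)`. -/
structure IsSemiRiemannianSubmersion (g : Metric I M) (h : Metric J N) (F : M → N) : Prop where
  contMDiff : ContMDiff I J ∞ F
  surjective : Function.Surjective F
  surjective_mfderiv : ∀ x : M, Function.Surjective (mfderiv I J F x)
  /-- The metric is nondegenerate on the tangent spaces of the fibers. -/
  fiber_nondegenerate : ∀ (x : M) (v : TangentSpace I x), IsVertical I J F x v →
    IsHorizontal J g F x v → v = 0
  isometry : ∀ (x : M) (v w : TangentSpace I x), IsHorizontal J g F x v →
    IsHorizontal J g F x w → h.val (F x) (mfderiv I J F x v) (mfderiv I J F x w) = g.val x v w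

/-- `φ (ker F_*) ⊆ (ker F_*)^⊥`. -/
def IsAntiInvariant {g : Metric I M} {ε : ℝ} (S : LorentzianAlmostContact g ε)
    (J : ModelWithCorners ℝ E' H') (F : M → N) : Prop :=
  ∀ (x : M) (v : TangentSpace I x), IsVertical I J F x v → IsHorizontal J g F x (S.phi x v)

variable [FiniteDimensional ℝ E]

variable (J) in
/-- The fiber `F⁻¹(q)` is a totally umbilical submanifold of `(M, g)`: there is a normal vector
field `Z` along it with `II(u, V) = g(u, V) Z` for all tangent `u`, `V`. Here `II(u, V)` is the
normal component of `∇_u V`; that it equals the normal vector `g(u, V) Z` is expressed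
by the difference being tangent to the fiber. -/
def FiberTotallyUmbilical (g : Metric I M) (F : M → N) (q : N) : Prop :=
  ∃ Z : ∀ x : M, TangentSpace I x, ∀ x : M, F x = q →
    IsHorizontal J g F x (Z x) ∧
    ∀ V : (∀ y : M, TangentSpace I y), CMDiff ∞ (T% V) → (∀ y, IsVertical I J F y (V y)) →
      ∀ u : TangentSpace I x, IsVertical I J F x u →
        IsVertical I J F x (g.leviCivita V x u - g.val x u (V x) • Z x)

end Submersion

end SemiRiem

end

namespace SemiRiem

namespace LorentzianAlmostContact

section Pointwise

variable {E : Type*} [NormedAddCommGroup E] [NormedSpace ℝ E]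
  {H : Type*} [TopologicalSpace H] {I : ModelWithCorners ℝ E H}
  {M : Type*} [TopologicalSpace M] [ChartedSpace H M] [IsManifold I ∞ M]
  {g : Metric I M} {ε : ℝ}

theorem eps_mul_eps (S : LorentzianAlmostContact g ε) : ε * ε = 1 := by
  rcases S.eps_eq with h | h <;> simp [h]

theorem eps_ne_zero (S : LorentzianAlmostContact g ε) : ε ≠ 0 :=
  left_ne_zero_of_mul_eq_one S.eps_mul_eps

/-- The characteristic vector field is unit timelike. -/
theorem val_xi_xi (S : LorentzianAlmostContact g ε) (x : M) :
    g.val x (S.xi x) (S.xi x) = -1 := by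
  have h := S.eta_eq x (S.xi x)
  rw [S.eta_xi] at h
  exact mul_left_cancel₀ S.eps_ne_zero (by linarith)

theorem xi_ne_zero (S : LorentzianAlmostContact g ε) (x : M) : S.xi x ≠ 0 := fun h ↦ by
  simpa [h] using S.val_xi_xi x

/-- The kernel of `φ` is spanned by the characteristic vector field. -/
theorem eq_smul_xi_of_phi_eq_zero (S : LorentzianAlmostContact g ε) {x : M}
    {v : TangentSpace I x} (hv : S.phi x v = 0) : v = -(ε * S.eta x v) • S.xi x := by
  have h := S.phi_phi x v
  rw [hv, map_zero] at h
  calc v = (ε * ε) • v := by rw [S.eps_mul_eps, one_smul]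
    _ = ε • (ε • v + S.eta x v • S.xi x) - (ε * S.eta x v) • S.xi x := by module
    _ = -(ε * S.eta x v) • S.xi x := by rw [← h]; module

@[simp] theorem phi_xi (S : LorentzianAlmostContact g ε) (x : M) : S.phi x (S.xi x) = 0 := by
  have hpp : S.phi x (S.phi x (S.xi x)) = 0 := by
    rw [S.phi_phi, S.eta_xi]; module
  have hη : S.eta x (S.phi x (S.xi x)) = 0 := by
    have h1 := S.metric_phi x (S.phi x (S.xi x)) (S.phi x (S.xi x))
    have h2 := S.metric_phi x (S.xi x) (S.xi x)
    rw [S.val_xi_xi, S.eta_xi] at h2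
    rw [hpp, map_zero] at h1
    have h3 := S.eps_mul_eps
    exact mul_self_eq_zero.1 (by linarith)
  rw [S.eq_smul_xi_of_phi_eq_zero hpp, hη]
  simp

@[simp] theorem eta_phi (S : LorentzianAlmostContact g ε) (x : M) (v : TangentSpace I x) :
    S.eta x (S.phi x v) = 0 := by
  have h1 := S.phi_phi x (S.phi x v)
  rw [S.phi_phi x v, map_add, map_smul, map_smul, S.phi_xi, smul_zero] at h1
  exact (smul_eq_zero.1 (left_eq_add.1 ((add_zero _).symm.trans h1))).resolve_right
    (S.xi_ne_zero x)

end Pointwise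

section Connection

variable {E : Type*} [NormedAddCommGroup E] [NormedSpace ℝ E]
  {H : Type*} [TopologicalSpace H] {I : ModelWithCorners ℝ E H}
  {M : Type*} [TopologicalSpace M] [ChartedSpace H M] [IsManifold I ∞ M]
  [FiniteDimensional ℝ E] {g : Metric I M} {ε : ℝ}

theorem eta_leviCivita_xi (S : LorentzianAlmostContact g ε) (x : M) (v : TangentSpace I x) :
    S.eta x (g.leviCivita S.xi x v) = 0 := by
  have hξ : MDiffAt (T% S.xi) x := S.contMDiff_xi.mdifferentiable (by simp) x
  have hv := FiberBundle.mdifferentiableAt_extend I E (V := (TangentSpace I : M → Type _)) v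
  have h := g.leviCivita_metric hv hξ hξ
  have hc : g.pair S.xi S.xi = fun _ ↦ (-1 : ℝ) := funext S.val_xi_xi
  rw [hc, FiberBundle.extend_apply_self, g.symm x (S.xi x), mvfderiv_const] at h
  rw [S.eta_eq]
  have h0 : g.val x (g.leviCivita S.xi x v) (S.xi x) = 0 := by
    simp at h; linarith
  rw [h0, mul_zero]

/-- On a Lorentzian (para) Sasakian manifold, `∇_X ξ = ε φ X`. -/
theorem IsSasakian.nablaXiEq {S : LorentzianAlmostContact g ε} (hS : S.IsSasakian) :
    S.NablaXiEq := by
  intro x v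
  have h := hS S.xi S.contMDiff_xi x v
  have hz : (fun y ↦ S.phi y (S.xi y)) = (0 : Π y : M, TangentSpace I y) := funext S.phi_xi
  rw [hz, CovariantDerivative.zero, S.phi_xi, map_zero, zero_smul, S.eta_xi,
    zero_add] at h
  change (0 : TangentSpace I x) - _ = _ at h
  rw [zero_sub] at h
  have hφ : S.phi x (g.leviCivita S.xi x v - ε • S.phi x v) = 0 := by
    rw [map_sub, map_smul, ← neg_eq_zero]
    rw [neg_sub, sub_eq_add_neg, h]
    module
  have hη : S.eta x (g.leviCivita S.xi x v - ε • S.phi x v) = 0 := by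
    simp [S.eta_leviCivita_xi]
  have := S.eq_smul_xi_of_phi_eq_zero hφ
  rw [hη] at this
  simpa [sub_eq_zero] using this

end Connection

end LorentzianAlmostContact

section Fibers

variable {E : Type*} [NormedAddCommGroup E] [NormedSpace ℝ E] [FiniteDimensional ℝ E]
  {H : Type*} [TopologicalSpace H] {I : ModelWithCorners ℝ E H}
  {M : Type*} [TopologicalSpace M] [ChartedSpace H M] [IsManifold I ∞ M]
  {E' : Type*} [NormedAddCommGroup E'] [NormedSpace ℝ E']
  {H' : Type*} [TopologicalSpace H'] {J : ModelWithCorners ℝ E' H'}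
  {N : Type*} [TopologicalSpace N] [ChartedSpace H' N] [IsManifold J ∞ N]
  {g : Metric I M} {h : Metric J N} {ε : ℝ} {S : LorentzianAlmostContact g ε} {F : M → N} {q : N}

/-- If `ξ` is vertical and `∇_X ξ = ε φ X`, then `φ` vanishes on the tangent spaces of every
totally umbilical fiber of an anti-invariant submersion. -/
theorem FiberTotallyUmbilical.phi_eq_zero (hq : FiberTotallyUmbilical J g F q)
    (hF : IsSemiRiemannianSubmersion g h F) (hS : S.NablaXiEq) (hanti : IsAntiInvariant S J F)
    (hxi : ∀ x, IsVertical I J F x (S.xi x)) {x : M} (hx : F x = q) {u : TangentSpace I x}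
    (hu : IsVertical I J F x u) : S.phi x u = 0 := by
  obtain ⟨Z, hZ⟩ := hq
  obtain ⟨hZh, hII⟩ := hZ x hx
  have hII := hII S.xi S.contMDiff_xi hxi
  have hZ0 : Z x = 0 := by
    refine hF.fiber_nondegenerate x _ ?_ hZh
    simpa [hS x, S.val_xi_xi] using hII _ (hxi x)
  refine hF.fiber_nondegenerate x _ ?_ (hanti x u hu)
  have h1 := hII u hu
  rw [hS x, hZ0, smul_zero, sub_zero, IsVertical, map_smul] at h1
  exact (smul_eq_zero.1 h1).resolve_left S.eps_ne_zero

end Fibers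

end SemiRiem

theorem mainTheorem12 (m n : ℕ) (hn : n < 2 * m)
    {M : Type*} [TopologicalSpace M] [T2Space M] [SecondCountableTopology M]
    [ChartedSpace (EuclideanSpace ℝ (Fin (2 * m + 1))) M] [IsManifold (𝓡 (2 * m + 1)) ∞ M]
    {N : Type*} [TopologicalSpace N] [T2Space N] [SecondCountableTopology N]
    [ChartedSpace (EuclideanSpace ℝ (Fin n)) N] [IsManifold (𝓡 n) ∞ N]
    (gM : SemiRiem.Metric (𝓡 (2 * m + 1)) M) (ε : ℝ) (S : SemiRiem.LorentzianAlmostContact gM ε)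
    (hS : S.IsSasakian ∨ S.NablaXiEq)
    (gN : SemiRiem.Metric (𝓡 n) N) (hN : gN.IsRiemannian)
    (F : M → N) (hF : SemiRiem.IsSemiRiemannianSubmersion gM gN F)
    (hanti : SemiRiem.IsAntiInvariant S (𝓡 n) F)
    (hxi : ∀ x : M, SemiRiem.IsVertical (𝓡 (2 * m + 1)) (𝓡 n) F x (S.xi x)) :
    ∀ q : N, ¬ SemiRiem.FiberTotallyUmbilical (𝓡 n) gM F q := by
  intro q hq
  obtain ⟨x, hx⟩ := hF.surjective q
  have hS : S.NablaXiEq := hS.elim (fun h ↦ h.nablaXiEq) id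
  let L : EuclideanSpace ℝ (Fin (2 * m + 1)) →ₗ[ℝ] EuclideanSpace ℝ (Fin n) :=
    (mfderiv (𝓡 (2 * m + 1)) (𝓡 n) F x).toLinearMap
  let ξ : EuclideanSpace ℝ (Fin (2 * m + 1)) := S.xi x
  have hle : LinearMap.ker L ≤ Submodule.span ℝ {ξ} := fun u hu ↦
    Submodule.mem_span_singleton.2 ⟨_, (S.eq_smul_xi_of_phi_eq_zero
      (hq.phi_eq_zero hF hS hanti hxi hx (u := u) hu)).symm⟩
  have h1 : finrank ℝ (LinearMap.ker L) ≤ 1 :=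
    (Submodule.finrank_mono hle).trans ((finrank_span_le_card {ξ}).trans (by simp))
  have h2 := L.finrank_range_add_finrank_ker
  have h3 := (LinearMap.range L).finrank_le
  simp only [finrank_euclideanSpace, Fintype.card_fin] at h2 h3
  omega
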